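/- Let $\mathcal H,\mathcal K$ be (real or complex, not necessarily separable) Hilbert spaces, $\mathcal M,\mathcal N\subseteq\mathcal H$ closed subspaces, and $A,B\in\mathcal B(\mathcal H,\mathcal K)$ bounded operators that coincide on $\mathcal M\cap\mathcal N$. Let $C_{\mathcal M,\mathcal N}(A,B)$ be the linear operator with domain $\mathcal M+\mathcal N$ that coincides with $A$ on $\mathcal M$ and with $B$ on $\mathcal N$; it is called bounded if it is bounded with respect to the norm of $\mathcal H$ on $\mathcal M+\mathcal N$. Let $\mathcal M_0$ be the orthogonal complement of $(\mathcal M\cap\mathcal N)\oplus(\mathcal M\cap\mathcal N^\perp)$ in $\mathcal M$, and $\mathcal M_1$ the orthogonal complement of $(\mathcal M^\perp\cap\mathcal N)\oplus(\mathcal M^\perp\cap\mathcal N^\perp)$ in $\mathcal M^\perp$. (a) If $\mathcal M_0=\{0\}$, then $C_{\mathcal M,\mathcal N}(A,B)$ is bounded. (b) Suppose $\mathcal M_0\neq\{0\}$. Then (Halmos) there are a unitary operator $R:\mathcal M_0\to\mathcal M_1$ and a positive contraction $S\in\mathcal B(\mathcal M_0)$, with $S$ and $1-S$ injective, such that the orthogonal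 projection $P_{\mathcal N}$ onto $\mathcal N$ satisfies $$P_{\mathcal N}|_{\mathcal M_0\oplus\mathcal M_1}=\begin{bmatrix}1-S^2 & S\sqrt{1-S^2}\,R^*\\ RS\sqrt{1-S^2} & RS^2R^*\end{bmatrix}.$$ Let $D:\mathcal M_0\to\mathcal K$ be the restriction of $A-B$ to $\mathcal M_0$. For every such pair $(R,S)$, the operator $C_{\mathcal M,\mathcal N}(A,B)$ is bounded if and only if $\mathcal R(D^*)\subseteq\mathcal R(S)$, where $\mathcal R$ denotes the range. -/

import Mathlib

noncomputable section

namespace TwoSubspaces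

variable {𝕜 H K : Type*} [RCLike 𝕜]
  [NormedAddCommGroup H] [InnerProductSpace 𝕜 H]
  [NormedAddCommGroup K] [InnerProductSpace 𝕜 K]

/-- The operator `C_{M,N}(A,B)`: its domain is `M + N`, it coincides with `A` on `M` and with `B`
on `N`. It is defined when `A` and `B` coincide on `M ∩ N`. -/
def simExt (M N : Submodule 𝕜 H) (A B : H →L[𝕜] K) (hAB : ∀ x ∈ M ⊓ N, A x = B x) :
    H →ₗ.[𝕜] K :=
  ((A : H →ₗ[𝕜] K).toPMap M).sup ((B : H →ₗ[𝕜] K).toPMap N) (by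
    rintro ⟨x, hx⟩ ⟨y, hy⟩ hxy
    obtain rfl : x = y := hxy
    exact hAB x ⟨hx, hy⟩)

/-- A partially defined linear operator is bounded, its domain carrying the norm of the ambient
space. -/
def IsBoundedOp (T : H →ₗ.[𝕜] K) : Prop :=
  ∃ c : ℝ, ∀ x : T.domain, ‖T x‖ ≤ c * ‖(x : H)‖

/-- The orthogonal complement in `M` of `(M ∩ N) ⊕ (M ∩ Nᗮ)`. Thus `genericPart M N` is the
subspace `M₀` and `genericPart Mᗮ N` is the subspace `M₁` of Halmos' decomposition. -/
def genericPart (M N : Submodule 𝕜 H) : Submodule 𝕜 H :=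
  M ⊓ ((M ⊓ N) ⊔ (M ⊓ Nᗮ))ᗮ

instance isClosed_genericPart (M N : Submodule 𝕜 H) [hM : IsClosed (M : Set H)] :
    IsClosed (genericPart M N : Set H) :=
  hM.inter (Submodule.isClosed_orthogonal _)

/-- `T` is the (unique) positive square root of `X`. -/
def IsPosSqrt (T X : H →L[𝕜] H) : Prop :=
  T.IsPositive ∧ T * T = X

/-- `R` and `S` are the operators of Halmos' two projections theorem for the pair `M`, `N`:
`R : M₀ → M₁` is unitary, `S` is a positive contraction on `M₀` such that `S` and `1 - S` are
injective, and, with respect to `M₀ ⊕ M₁`, the orthogonal projection onto `N` has the matrix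
`[[1 - S², S √(1 - S²) R*], [R S √(1 - S²), R S² R*]]`. The adjoint of the unitary `R` is its
inverse `R.symm`. -/
structure IsHalmosPair [CompleteSpace H] (M N : Submodule 𝕜 H) [IsClosed (N : Set H)]
    (R : genericPart M N ≃ₗᵢ[𝕜] genericPart Mᗮ N)
    (S : genericPart M N →L[𝕜] genericPart M N) : Prop where
  isPositive : S.IsPositive
  norm_le_one : ‖S‖ ≤ 1
  injective : Function.Injective S
  injective_one_sub : Function.Injective (1 - S : genericPart M N →L[𝕜] genericPart M N)
  matrix : ∃ T : genericPart M N →L[𝕜] genericPart M N, IsPosSqrt T (1 - S * S) ∧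
    ∀ (x : genericPart M N) (y : genericPart Mᗮ N),
      N.starProjection ((x : H) + (y : H)) =
        (((1 - S * S) x + (S * T) (R.symm y) : genericPart M N) : H) +
        ((R ((S * T) x) + R ((S * S) (R.symm y)) : genericPart Mᗮ N) : H)

/-- The operator `D : M₀ → K`, the restriction of `A - B` to `M₀`. -/
def diffRestrict (M N : Submodule 𝕜 H) (A B : H →L[𝕜] K) : genericPart M N →L[𝕜] K :=
  (A - B) ∘L (genericPart M N).subtypeL

end TwoSubspaces

end

/-!
The operator `C_{M,N}(A, B)` is bounded exactly when `‖(A - B) m‖ ≤ c ‖P_{Nᗮ} m‖` on `M`, because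
`P_{Nᗮ} m` is the shortest vector of `m + N`. This inequality is trivial on `M ∩ N`, where both
sides vanish, and on `M ∩ Nᗮ`, where `P_{Nᗮ} m = m`, so only the generic part `M₀` matters. There
`‖P_{Nᗮ} x‖ = ‖S x‖` by the matrix of `P_N`, and Douglas' lemma turns `‖D x‖ ≤ c ‖S x‖` into the
inclusion of ranges.

For Halmos' theorem, write `[[X, Q*], [Q, Y]]` for the matrix of `P_N` on `M₀ ⊕ M₁`. Then
`S = √(1 - X)`, `T = √X`, and `R` is the unitary part of `Q`: idempotence gives
`Q* Q = X - X² = (S T)²`, hence `Q = R S T`, and `Y Q = Q (1 - X)`, hence `Y = R S² R*`. The square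
roots are obtained by iteration since the scalars may be real, where no functional calculus for
operators is available.
-/

namespace TwoSubspaces

open ContinuousLinearMap Filter Topology

/-! ### Square roots -/

section SqrtIter

/-- The successive approximations, started at `0`, to the solution `w` of `w = (y + w²) / 2`,
equivalently of `(1 - w)² = 1 - y`. -/
def sqrtIter (𝕜 : Type*) {𝔸 : Type*} [DivisionRing 𝕜] [Ring 𝔸] [Module 𝕜 𝔸] (y : 𝔸) : ℕ → 𝔸
  | 0 => 0
  | n + 1 => (2⁻¹ : 𝕜) • (y + sqrtIter 𝕜 y n * sqrtIter 𝕜 y n)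

section Algebra

variable {𝕜 𝔸 : Type*} [Field 𝕜] [Ring 𝔸] [Algebra 𝕜 𝔸]

lemma commute_sqrtIter {y z : 𝔸} (h : Commute y z) (n : ℕ) : Commute (sqrtIter 𝕜 y n) z := by
  induction n with
  | zero => exact Commute.zero_left z
  | succ n ih => exact (h.add_left (ih.mul_left ih)).smul_left _

lemma sqrtIter_succ_succ_sub (y : 𝔸) (n : ℕ) :
    sqrtIter 𝕜 y (n + 2) - sqrtIter 𝕜 y (n + 1) = (2⁻¹ : 𝕜) •
      ((sqrtIter 𝕜 y (n + 1) + sqrtIter 𝕜 y n) * (sqrtIter 𝕜 y (n + 1) - sqrtIter 𝕜 y n)) := by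
  have hcomm : Commute (sqrtIter 𝕜 y (n + 1)) (sqrtIter 𝕜 y n) :=
    commute_sqrtIter (commute_sqrtIter (Commute.refl y) n).symm (n + 1)
  rw [← hcomm.mul_self_sub_mul_self_eq,
    ← add_sub_add_left_eq_sub (_ * _) (sqrtIter 𝕜 y n * _) y, smul_sub]
  rfl

end Algebra

lemma sqrtIter_one_mem_Icc (n : ℕ) : sqrtIter ℝ (1 : ℝ) n ∈ Set.Icc 0 1 := by
  induction n with
  | zero => simp [sqrtIter]
  | succ n ih =>
    obtain ⟨h0, h1⟩ := ih
    simp only [sqrtIter, smul_eq_mul]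
    constructor <;> nlinarith

lemma monotone_sqrtIter_one : Monotone (sqrtIter ℝ (1 : ℝ)) := by
  refine monotone_nat_of_le_succ fun n => ?_
  simp only [sqrtIter, smul_eq_mul]
  nlinarith [sq_nonneg (1 - sqrtIter ℝ (1 : ℝ) n)]

section Normed

variable {𝕜 𝔸 : Type*} [RCLike 𝕜] [NormedRing 𝔸] [NormedAlgebra 𝕜 𝔸] {y : 𝔸}

lemma norm_sqrtIter_le (hy : ‖y‖ ≤ 1) (n : ℕ) : ‖sqrtIter 𝕜 y n‖ ≤ sqrtIter ℝ (1 : ℝ) n := by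
  induction n with
  | zero => simp [sqrtIter]
  | succ n ih =>
    simp only [sqrtIter, norm_smul, norm_inv, RCLike.norm_ofNat, smul_eq_mul]
    gcongr
    exact norm_add_le_of_le hy (norm_mul_le_of_le ih ih)

lemma norm_sqrtIter_succ_sub_le (hy : ‖y‖ ≤ 1) (n : ℕ) :
    ‖sqrtIter 𝕜 y (n + 1) - sqrtIter 𝕜 y n‖ ≤
      sqrtIter ℝ (1 : ℝ) (n + 1) - sqrtIter ℝ (1 : ℝ) n := by
  induction n with
  | zero => simpa only [sqrtIter.eq_1, sub_zero] using norm_sqrtIter_le hy 1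
  | succ n ih =>
    rw [sqrtIter_succ_succ_sub, sqrtIter_succ_succ_sub, norm_smul, norm_inv, RCLike.norm_ofNat,
      smul_eq_mul]
    gcongr
    exact norm_mul_le_of_le
      (norm_add_le_of_le (norm_sqrtIter_le hy _) (norm_sqrtIter_le hy _)) ih

lemma cauchySeq_sqrtIter (hy : ‖y‖ ≤ 1) : CauchySeq (sqrtIter 𝕜 y) := by
  have hsum : Summable fun n => sqrtIter ℝ (1 : ℝ) (n + 1) - sqrtIter ℝ (1 : ℝ) n := by
    refine summable_of_sum_range_le (c := 1)
      (fun n => sub_nonneg.2 (monotone_sqrtIter_one n.le_succ)) fun n => ?_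
    rw [Finset.sum_range_sub]
    simpa only [sqrtIter.eq_1, sub_zero] using (sqrtIter_one_mem_Icc n).2
  refine cauchySeq_of_dist_le_of_summable _ (fun n => ?_) hsum
  rw [dist_comm, dist_eq_norm]
  exact norm_sqrtIter_succ_sub_le hy n

lemma one_sub_mul_one_sub_of_tendsto_sqrtIter {w : 𝔸}
    (hw : Tendsto (sqrtIter 𝕜 y) atTop (𝓝 w)) : (1 - w) * (1 - w) = 1 - y := by
  have hfix : w = (2⁻¹ : 𝕜) • (y + w * w) :=
    tendsto_nhds_unique ((tendsto_add_atTop_iff_nat 1).2 hw)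
      ((tendsto_const_nhds.add (hw.mul hw)).const_smul _)
  have hdouble : w + w = y + w * w := by
    rw [← two_smul 𝕜 w]
    conv_lhs => rw [hfix, smul_inv_smul₀ two_ne_zero]
  calc (1 - w) * (1 - w) = 1 - (w + w) + w * w := by noncomm_ring
    _ = 1 - y := by rw [hdouble]; abel

end Normed

end SqrtIter

section PosSqrt

variable {𝕜 E : Type*} [RCLike 𝕜] [NormedAddCommGroup E] [InnerProductSpace 𝕜 E]

lemma isPositive_one_sub [CompleteSpace E] {w : E →L[𝕜] E} (hw : IsSelfAdjoint w)
    (hnorm : ‖w‖ ≤ 1) : (1 - w).IsPositive := by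
  refine isPositive_def'.2 ⟨(IsSelfAdjoint.one _).sub hw, fun x => ?_⟩
  have hle : RCLike.re (inner 𝕜 (w x) x) ≤ ‖x‖ * ‖x‖ :=
    (re_inner_le_norm _ _).trans (by gcongr; simpa using w.le_of_opNorm_le hnorm x)
  simpa [reApplyInnerSelf, inner_sub_left, sq] using hle

lemma isSelfAdjoint_sqrtIter [CompleteSpace E] {y : E →L[𝕜] E} (hy : IsSelfAdjoint y) (n : ℕ) :
    IsSelfAdjoint (sqrtIter 𝕜 y n) := by
  induction n with
  | zero => exact IsSelfAdjoint.zero _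
  | succ n ih =>
    exact IsSelfAdjoint.smul (by simp [IsSelfAdjoint])
      (hy.add ((IsSelfAdjoint.commute_iff ih ih).1 (Commute.refl _)))

theorem exists_isPosSqrt_one_sub [CompleteSpace E] {y : E →L[𝕜] E} (hy : IsSelfAdjoint y)
    (hnorm : ‖y‖ ≤ 1) :
    ∃ T : E →L[𝕜] E, IsPosSqrt T (1 - y) ∧ ∀ z, Commute y z → Commute T z := by
  obtain ⟨w, hw⟩ := cauchySeq_tendsto_of_complete (cauchySeq_sqrtIter (𝕜 := 𝕜) hnorm)
  have hsa : IsSelfAdjoint w :=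
    (isClosed_eq continuous_star continuous_id).mem_of_tendsto hw
      (Eventually.of_forall (isSelfAdjoint_sqrtIter hy))
  have hw1 : ‖w‖ ≤ 1 := le_of_tendsto hw.norm
    (Eventually.of_forall fun n => (norm_sqrtIter_le hnorm n).trans (sqrtIter_one_mem_Icc n).2)
  refine ⟨1 - w, ⟨isPositive_one_sub hsa hw1, one_sub_mul_one_sub_of_tendsto_sqrtIter hw⟩,
    fun z hz => (Commute.one_left z).sub_left ?_⟩
  exact (isClosed_eq (continuous_mul_const z) (continuous_const_mul z)).mem_of_tendsto hw
    (Eventually.of_forall fun n => commute_sqrtIter hz n)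

lemma exists_commute_isPosSqrt [CompleteSpace E] {X : E →L[𝕜] E} (hX : IsSelfAdjoint X)
    (hX1 : ‖X‖ ≤ 1) (hX2 : ‖1 - X‖ ≤ 1) :
    ∃ S T : E →L[𝕜] E, IsPosSqrt S (1 - X) ∧ IsPosSqrt T X ∧ Commute S T := by
  obtain ⟨S, hS, hScomm⟩ := exists_isPosSqrt_one_sub hX hX1
  obtain ⟨T, hT, hTcomm⟩ := exists_isPosSqrt_one_sub ((IsSelfAdjoint.one _).sub hX) hX2
  rw [sub_sub_cancel] at hT
  have hXS : Commute X S := (hScomm X (Commute.refl X)).symm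
  exact ⟨S, T, hS, hT, (hTcomm S ((Commute.one_left S).sub_left hXS)).symm⟩

namespace IsPosSqrt

variable {T X : E →L[𝕜] E}

lemma injective (h : IsPosSqrt T X) (hX : Function.Injective X) : Function.Injective T := by
  rw [← h.2] at hX
  exact Function.Injective.of_comp (f := T) hX

lemma norm_le_one [CompleteSpace E] (h : IsPosSqrt T X) (hX : ‖X‖ ≤ 1) : ‖T‖ ≤ 1 := by
  have hsq : ‖T‖ * ‖T‖ = ‖X‖ := by
    rw [← CStarRing.norm_star_mul_self, h.1.isSelfAdjoint.star_eq, h.2]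
  nlinarith [norm_nonneg T]

lemma injective_one_sub (h : IsPosSqrt T X) (hX : Function.Injective (1 - X : E →L[𝕜] E)) :
    Function.Injective (1 - T : E →L[𝕜] E) := by
  have hfactor : 1 - X = (1 + T) * (1 - T) := by rw [← h.2]; noncomm_ring
  rw [hfactor] at hX
  exact Function.Injective.of_comp (f := ⇑(1 + T)) hX

end IsPosSqrt

end PosSqrt

/-! ### Factorization of operators -/

section Factorization

variable {𝕜 E F G : Type*} [RCLike 𝕜]
  [NormedAddCommGroup E] [InnerProductSpace 𝕜 E]
  [NormedAddCommGroup F] [InnerProductSpace 𝕜 F] [CompleteSpace F]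
  [NormedAddCommGroup G] [InnerProductSpace 𝕜 G] [CompleteSpace G]

lemma exists_comp_eq_of_norm_le {S : E →L[𝕜] G} {D : E →L[𝕜] F} {c : ℝ}
    (h : ∀ x, ‖D x‖ ≤ c * ‖S x‖) : ∃ Z : G →L[𝕜] F, Z ∘L S = D := by
  let W := S.range.topologicalClosure
  have : CompleteSpace W := S.range.isClosed_topologicalClosure.completeSpace_coe
  let S' : E →L[𝕜] W := S.codRestrict W fun x => S.range.le_topologicalClosure ⟨x, rfl⟩
  have hdense : DenseRange S' := by
    refine Subtype.dense_iff.2 fun z hz => ?_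
    rwa [← Set.range_comp]
  refine ⟨(D : E →ₗ[𝕜] F).extendOfNorm (S' : E →ₗ[𝕜] W) ∘L W.orthogonalProjectionOnto,
    ContinuousLinearMap.ext fun x => ?_⟩
  have hproj : W.orthogonalProjectionOnto (S x) = S' x :=
    W.orthogonalProjectionOnto_mem_subspace_eq_self (S' x)
  rw [comp_apply, comp_apply, hproj]
  exact LinearMap.extendOfNorm_eq (f := (D : E →ₗ[𝕜] F)) (e := (S' : E →ₗ[𝕜] W)) hdense ⟨c, h⟩ x

lemma exists_norm_le_mul_of_forall_inner {ι : Type*} {v : ι → F} {b : ι → ℝ} (hb : ∀ i, 0 ≤ b i)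
    (h : ∀ k : F, ∃ C, ∀ i, ‖inner 𝕜 (v i) k‖ ≤ C * b i) : ∃ c, ∀ i, ‖v i‖ ≤ c * b i := by
  have hscaled (k : F) : ∃ C, ∀ i, ‖((b i)⁻¹ : 𝕜) • innerSL 𝕜 (v i) k‖ ≤ C := by
    obtain ⟨C, hC⟩ := h k
    refine ⟨|C|, fun i => ?_⟩
    rw [norm_smul, norm_inv, RCLike.norm_of_nonneg (hb i), innerSL_apply_apply]
    calc (b i)⁻¹ * ‖inner 𝕜 (v i) k‖ ≤ (b i)⁻¹ * (|C| * b i) := by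
          have := hb i
          gcongr
          exact (hC i).trans (by gcongr; exact le_abs_self C)
      _ = |C| * ((b i)⁻¹ * b i) := by ring
      _ ≤ |C| := mul_le_of_le_one_right (abs_nonneg C) inv_mul_le_one
  obtain ⟨c, hc⟩ := banach_steinhaus (g := fun i => ((b i)⁻¹ : 𝕜) • innerSL 𝕜 (v i)) hscaled
  refine ⟨c, fun i => ?_⟩
  -- Since `0⁻¹ = 0`, the rescaled bound says nothing when `b i = 0`; then `v i = 0` by `h`.
  rcases (hb i).eq_or_lt with hi | hi
  · obtain ⟨C, hC⟩ := h (v i)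
    have hzero : inner 𝕜 (v i) (v i) = 0 := by simpa [← hi] using hC i
    simp [inner_self_eq_zero.1 hzero, ← hi]
  · have hci := hc i
    rwa [norm_smul, norm_inv, RCLike.norm_of_nonneg hi.le, innerSL_apply_norm,
      inv_mul_le_iff₀ hi, mul_comm] at hci

variable [CompleteSpace E]

/-- **Douglas' lemma**. -/
theorem range_adjoint_le_range_adjoint_iff (D : E →L[𝕜] F) (S : E →L[𝕜] G) :
    (adjoint D).range ≤ (adjoint S).range ↔ ∃ c : ℝ, ∀ x, ‖D x‖ ≤ c * ‖S x‖ := by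
  refine ⟨fun h => ?_, fun ⟨c, hc⟩ => ?_⟩
  · refine exists_norm_le_mul_of_forall_inner (𝕜 := 𝕜) (fun x => norm_nonneg _) fun k => ?_
    obtain ⟨u, hu⟩ := h ⟨k, rfl⟩
    refine ⟨‖u‖, fun x => ?_⟩
    calc ‖inner 𝕜 (D x) k‖ = ‖inner 𝕜 (S x) u‖ := by
          rw [← adjoint_inner_right, ← adjoint_inner_right]
          exact congr_arg (fun z => ‖inner 𝕜 x z‖) hu.symm
      _ ≤ ‖u‖ * ‖S x‖ := (norm_inner_le_norm _ _).trans_eq (mul_comm _ _)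
  · obtain ⟨Z, rfl⟩ := exists_comp_eq_of_norm_le hc
    rw [adjoint_comp]
    exact LinearMap.range_comp_le_range _ _

lemma denseRange_of_injective_adjoint {T : E →L[𝕜] F} (h : Function.Injective (adjoint T)) :
    DenseRange T := by
  have hclosure : T.range.topologicalClosure = ⊤ := by
    rw [Submodule.topologicalClosure_eq_top_iff, orthogonal_range]
    exact LinearMap.ker_eq_bot.2 h
  exact Submodule.dense_iff_topologicalClosure_eq_top.2 hclosure

lemma exists_linearIsometryEquiv_comp_eq {P : E →L[𝕜] F} {Q : E →L[𝕜] G} (hP : DenseRange P)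
    (hQ : DenseRange Q) (h : adjoint P ∘L P = adjoint Q ∘L Q) :
    ∃ R : F ≃ₗᵢ[𝕜] G, ∀ x, R (P x) = Q x := by
  have hnorm (x : E) : ‖Q x‖ = ‖P x‖ := by
    rw [apply_norm_eq_sqrt_inner_adjoint_left, apply_norm_eq_sqrt_inner_adjoint_left, h]
  exact ⟨_, (LinearEquiv.refl 𝕜 E).extendOfIsometry_eq (P : E →ₗ[𝕜] F) (Q : E →ₗ[𝕜] G) hP hQ hnorm⟩

lemma exists_unitary_comp_sqrt_eq {X : E →L[𝕜] E} {Q : E →L[𝕜] F}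
    (hX : IsSelfAdjoint X) (hX1 : ‖X‖ ≤ 1) (hX2 : ‖1 - X‖ ≤ 1)
    (hXinj : Function.Injective X) (hXinj' : Function.Injective (1 - X : E →L[𝕜] E))
    (hQinj : Function.Injective (adjoint Q)) (hXQ : X ∘L X + adjoint Q ∘L Q = X) :
    ∃ (R : E ≃ₗᵢ[𝕜] F) (S T : E →L[𝕜] E), IsPosSqrt S (1 - X) ∧ IsPosSqrt T X ∧
      Commute S T ∧ DenseRange (S * T : E →L[𝕜] E) ∧ ∀ x, Q x = R ((S * T) x) := by
  obtain ⟨S, T, hS, hT, hST⟩ := exists_commute_isPosSqrt hX hX1 hX2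
  have hSTadj : adjoint (S * T) = S * T :=
    (IsSelfAdjoint.commute_iff hS.1.isSelfAdjoint hT.1.isSelfAdjoint).1 hST
  have hSTinj : Function.Injective (S * T : E →L[𝕜] E) :=
    (hS.injective hXinj').comp (hT.injective hXinj)
  have hSTdense : DenseRange (S * T : E →L[𝕜] E) :=
    denseRange_of_injective_adjoint (by rwa [hSTadj])
  have hgram : adjoint (S * T) ∘L (S * T) = adjoint Q ∘L Q :=
    calc adjoint (S * T) ∘L (S * T) = (S * T) * (S * T) := by rw [hSTadj]; rfl
      _ = (1 - X) * X := by rw [hST.symm.mul_mul_mul_comm, hS.2, hT.2]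
      _ = X - X * X := by noncomm_ring
      _ = adjoint Q ∘L Q := sub_eq_of_eq_add' hXQ.symm
  obtain ⟨R, hR⟩ := exists_linearIsometryEquiv_comp_eq hSTdense
    (denseRange_of_injective_adjoint hQinj) hgram
  exact ⟨R, S, T, hS, hT, hST, hSTdense, fun x => (hR x).symm⟩

theorem exists_unitary_of_blocks {X : E →L[𝕜] E} {Q : E →L[𝕜] F} {Y : F →L[𝕜] F}
    (hX : IsSelfAdjoint X) (hX1 : ‖X‖ ≤ 1) (hX2 : ‖1 - X‖ ≤ 1)
    (hXinj : Function.Injective X) (hXinj' : Function.Injective (1 - X : E →L[𝕜] E))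
    (hQinj : Function.Injective (adjoint Q))
    (hXQ : X ∘L X + adjoint Q ∘L Q = X) (hQY : Q ∘L X + Y ∘L Q = Q) :
    ∃ (R : E ≃ₗᵢ[𝕜] F) (S T : E →L[𝕜] E), IsPosSqrt S (1 - X) ∧ IsPosSqrt T X ∧
      (∀ x, Q x = R ((S * T) x)) ∧ (∀ y, adjoint Q y = (S * T) (R.symm y)) ∧
      ∀ y, Y y = R ((1 - X) (R.symm y)) := by
  obtain ⟨R, S, T, hS, hT, hST, hdense, hQ⟩ :=
    exists_unitary_comp_sqrt_eq hX hX1 hX2 hXinj hXinj' hQinj hXQ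
  refine ⟨R, S, T, hS, hT, hQ, fun y => ?_, fun y => ?_⟩
  · refine ext_inner_right 𝕜 fun x => ?_
    have hadj := (IsSelfAdjoint.commute_iff hS.1.isSelfAdjoint hT.1.isSelfAdjoint).1 hST
    rw [adjoint_inner_left, hQ, ← R.symm.inner_map_map, R.symm_apply_apply]
    exact (hadj.isSymmetric _ _).symm
  · obtain ⟨x, rfl⟩ := R.surjective y
    rw [R.symm_apply_apply]
    refine hdense.induction_on (p := fun x => Y (R x) = R ((1 - X) x)) x
      (isClosed_eq (by fun_prop) (by fun_prop)) fun x => ?_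
    have hcomm : (1 - X) * (S * T) = (S * T) * (1 - X) := by
      rw [← hS.2]
      exact ((Commute.refl S).mul_right hST).mul_left ((Commute.refl S).mul_right hST)
    calc Y (R ((S * T) x)) = Q x - Q (X x) := by
          rw [← hQ]; exact eq_sub_of_add_eq' (DFunLike.congr_fun hQY x)
      _ = R ((S * T) ((1 - X) x)) := by rw [← map_sub, hQ]; rfl
      _ = R ((1 - X) ((S * T) x)) := congr_arg R (DFunLike.congr_fun hcomm x).symm

end Factorization

/-! ### Blocks of operators -/

section Block

variable {𝕜 H : Type*} [RCLike 𝕜] [NormedAddCommGroup H] [InnerProductSpace 𝕜 H]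

/-- The entry `P_V P|_U` of the operator matrix of `P` whose column is the subspace `U` and whose
row is the subspace `V`. -/
noncomputable def block (P : H →L[𝕜] H) (U V : Submodule 𝕜 H) [V.HasOrthogonalProjection] :
    U →L[𝕜] V :=
  V.orthogonalProjectionOnto ∘L P ∘L U.subtypeL

lemma norm_block_starProjection_le (N U V : Submodule 𝕜 H) [N.HasOrthogonalProjection]
    [V.HasOrthogonalProjection] : ‖block N.starProjection U V‖ ≤ 1 :=
  opNorm_le_bound _ zero_le_one fun x => by
    rw [one_mul]
    exact (V.norm_orthogonalProjectionOnto_apply_le _).trans (N.norm_starProjection_apply_le x)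

lemma one_sub_block_starProjection (N U : Submodule 𝕜 H) [N.HasOrthogonalProjection]
    [U.HasOrthogonalProjection] :
    1 - block N.starProjection U U = block Nᗮ.starProjection U U := by
  ext x
  simp [block, N.starProjection_orthogonal']

lemma coe_block_add_coe_block {P : H →L[𝕜] H} {U V W : Submodule 𝕜 H} [U.HasOrthogonalProjection]
    [V.HasOrthogonalProjection] (hUV : U ⟂ V) {x : W} (hx : P x ∈ U ⊔ V) :
    (block P W U x : H) + block P W V x = P x := by
  obtain ⟨u, hu, v, hv, huv⟩ := Submodule.mem_sup.1 hx
  change U.starProjection (P x) + V.starProjection (P x) = P x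
  rw [← huv, map_add, map_add, Submodule.starProjection_eq_self_iff.2 hu,
    Submodule.starProjection_eq_self_iff.2 hv,
    (Submodule.starProjection_apply_eq_zero_iff _).2 (hUV.ge hv),
    (Submodule.starProjection_apply_eq_zero_iff _).2 (hUV.le hu), add_zero, zero_add]

lemma block_comp_add_block_comp (P' : H →L[𝕜] H) {P : H →L[𝕜] H} {U V W : Submodule 𝕜 H}
    (Z : Submodule 𝕜 H) [U.HasOrthogonalProjection] [V.HasOrthogonalProjection]
    [Z.HasOrthogonalProjection] (hUV : U ⟂ V) (hW : ∀ x ∈ W, P x ∈ U ⊔ V) :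
    block P' U Z ∘L block P W U + block P' V Z ∘L block P W V = block (P' ∘L P) W Z := by
  ext x
  simp only [block, add_apply, comp_apply, Submodule.subtypeL_apply]
  rw [← map_add, ← map_add]
  exact congr_arg (fun z => (Z.orthogonalProjectionOnto (P' z) : H))
    (coe_block_add_coe_block hUV (hW x x.2))

lemma injective_block_starProjection {N U : Submodule 𝕜 H} [N.HasOrthogonalProjection]
    [U.HasOrthogonalProjection] (h : Disjoint U Nᗮ) :
    Function.Injective (block N.starProjection U U) := by
  refine (injective_iff_map_eq_zero _).2 fun x hx => Subtype.ext ?_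
  refine Submodule.disjoint_def.1 h x x.2 ((Submodule.starProjection_apply_eq_zero_iff N).1 ?_)
  have hinner : inner 𝕜 (N.starProjection (x : H)) (x : H) = 0 :=
    calc inner 𝕜 (N.starProjection (x : H)) (x : H) = inner 𝕜 (block N.starProjection U U x) x :=
          (U.inner_orthogonalProjectionOnto_eq_of_mem_right x _).symm
      _ = 0 := by rw [hx, inner_zero_left]
  have hnorm := N.re_inner_starProjection_eq_normSq (x : H)
  rw [hinner] at hnorm
  simpa using hnorm.symm

lemma adjoint_block [CompleteSpace H] (P : H →L[𝕜] H) (U V : Submodule 𝕜 H) [CompleteSpace U]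
    [CompleteSpace V] : adjoint (block P U V) = block (adjoint P) V U := by
  rw [block, block, adjoint_comp, adjoint_comp, Submodule.adjoint_subtypeL,
    Submodule.adjoint_orthogonalProjectionOnto, comp_assoc]

lemma adjoint_block_starProjection [CompleteSpace H] (N U V : Submodule 𝕜 H)
    [N.HasOrthogonalProjection] [CompleteSpace U] [CompleteSpace V] :
    adjoint (block N.starProjection U V) = block N.starProjection V U := by
  rw [adjoint_block, (isSelfAdjoint_starProjection N).adjoint_eq]

end Block

/-! ### Two subspaces -/

section GenericPart

variable {𝕜 H : Type*} [RCLike 𝕜] [NormedAddCommGroup H] [InnerProductSpace 𝕜 H]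
  {M N : Submodule 𝕜 H}

instance isClosed_coe_orthogonal (M : Submodule 𝕜 H) : IsClosed (Mᗮ : Set H) :=
  M.isClosed_orthogonal

lemma mem_genericPart {x : H} :
    x ∈ genericPart M N ↔ x ∈ M ∧ x ∈ (M ⊓ N)ᗮ ∧ x ∈ (M ⊓ Nᗮ)ᗮ := by
  rw [genericPart, ← Submodule.inf_orthogonal]
  rfl

lemma genericPart_le : genericPart M N ≤ M := inf_le_left

lemma isOrtho_genericPart : genericPart M N ⟂ genericPart Mᗮ N :=
  (Submodule.isOrtho_orthogonal_right M).mono genericPart_le genericPart_le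

lemma disjoint_genericPart : Disjoint (genericPart M N) N :=
  Submodule.disjoint_def.2 fun x hx hxN =>
    inner_self_eq_zero.1 ((mem_genericPart.1 hx).2.1 x ⟨genericPart_le hx, hxN⟩)

lemma disjoint_genericPart_orthogonal : Disjoint (genericPart M N) Nᗮ :=
  Submodule.disjoint_def.2 fun x hx hxN =>
    inner_self_eq_zero.1 ((mem_genericPart.1 hx).2.2 x ⟨genericPart_le hx, hxN⟩)

lemma sup_genericPart [(M ⊓ N).HasOrthogonalProjection] [(M ⊓ Nᗮ).HasOrthogonalProjection] :
    (M ⊓ N) ⊔ ((M ⊓ Nᗮ) ⊔ genericPart M N) = M := by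
  have hle : M ⊓ Nᗮ ≤ (M ⊓ N)ᗮ ⊓ M :=
    le_inf (inf_le_right.trans (Submodule.orthogonal_le inf_le_right)) inf_le_left
  have hgen : genericPart M N = (M ⊓ Nᗮ)ᗮ ⊓ ((M ⊓ N)ᗮ ⊓ M) := by
    rw [genericPart, ← Submodule.inf_orthogonal, inf_comm, inf_comm (M ⊓ N)ᗮ, inf_assoc]
  rw [hgen, Submodule.sup_orthogonal_inf_of_hasOrthogonalProjection hle,
    Submodule.sup_orthogonal_inf_of_hasOrthogonalProjection inf_le_left]

lemma starProjection_starProjection_mem_genericPart [M.HasOrthogonalProjection]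
    [N.HasOrthogonalProjection] {x : H} (hx : x ∈ (M ⊓ N)ᗮ) :
    M.starProjection (N.starProjection x) ∈ genericPart M N := by
  refine mem_genericPart.2 ⟨M.starProjection_apply_mem _, fun z hz => ?_, fun z hz => ?_⟩ <;>
    rw [← M.inner_starProjection_left_eq_right, Submodule.starProjection_eq_self_iff.2 hz.1,
      ← N.inner_starProjection_left_eq_right]
  · rw [Submodule.starProjection_eq_self_iff.2 hz.2]
    exact hx z hz
  · rw [(Submodule.starProjection_apply_eq_zero_iff N).2 hz.2, inner_zero_left]

lemma starProjection_mem_sup_genericPart [M.HasOrthogonalProjection] [N.HasOrthogonalProjection]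
    {x : H} (hx : x ∈ (M ⊓ N)ᗮ) (hx' : x ∈ (Mᗮ ⊓ N)ᗮ) :
    N.starProjection x ∈ genericPart M N ⊔ genericPart Mᗮ N := by
  rw [← M.starProjection_add_starProjection_orthogonal (N.starProjection x)]
  exact Submodule.add_mem_sup (starProjection_starProjection_mem_genericPart hx)
    (starProjection_starProjection_mem_genericPart hx')

lemma starProjection_mem_sup_of_mem_genericPart [M.HasOrthogonalProjection]
    [N.HasOrthogonalProjection] {x : H} (hx : x ∈ genericPart M N) :
    N.starProjection x ∈ genericPart M N ⊔ genericPart Mᗮ N :=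
  starProjection_mem_sup_genericPart (mem_genericPart.1 hx).2.1
    (Submodule.orthogonal_le inf_le_left (M.le_orthogonal_orthogonal (genericPart_le hx)))

lemma starProjection_mem_sup_of_mem_genericPart_orthogonal [M.HasOrthogonalProjection]
    [N.HasOrthogonalProjection] {x : H} (hx : x ∈ genericPart Mᗮ N) :
    N.starProjection x ∈ genericPart M N ⊔ genericPart Mᗮ N :=
  starProjection_mem_sup_genericPart (Submodule.orthogonal_le inf_le_left (genericPart_le hx))
    (mem_genericPart.1 hx).2.1

end GenericPart

section Halmos

variable {𝕜 H : Type*} [RCLike 𝕜] [NormedAddCommGroup H] [InnerProductSpace 𝕜 H] [CompleteSpace H]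
  {M N : Submodule 𝕜 H}

lemma injective_adjoint_block_genericPart [IsClosed (M : Set H)] [IsClosed (N : Set H)] :
    Function.Injective
      (adjoint (block N.starProjection (genericPart M N) (genericPart Mᗮ N))) := by
  rw [adjoint_block_starProjection]
  refine (injective_iff_map_eq_zero _).2 fun y hy => Subtype.ext ?_
  have hmem : N.starProjection (y : H) ∈ genericPart Mᗮ N := by
    rw [← coe_block_add_coe_block isOrtho_genericPart
      (starProjection_mem_sup_of_mem_genericPart_orthogonal y.2), hy, Submodule.coe_zero, zero_add]
    exact Submodule.coe_mem _
  have hzero : N.starProjection (y : H) = 0 :=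
    Submodule.disjoint_def.1 disjoint_genericPart _ hmem (N.starProjection_apply_mem _)
  exact Submodule.disjoint_def.1 disjoint_genericPart_orthogonal _ y.2
    ((Submodule.starProjection_apply_eq_zero_iff N).1 hzero)

theorem exists_isHalmosPair (M N : Submodule 𝕜 H) [IsClosed (M : Set H)] [IsClosed (N : Set H)] :
    ∃ (R : genericPart M N ≃ₗᵢ[𝕜] genericPart Mᗮ N)
      (S : genericPart M N →L[𝕜] genericPart M N), IsHalmosPair M N R S := by
  set U := genericPart M N
  set V := genericPart Mᗮ N
  set P := N.starProjection
  have hidem (W : Submodule 𝕜 H) [CompleteSpace W] :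
      block P U W ∘L block P U U + block P V W ∘L block P U V = block P U W := by
    rw [block_comp_add_block_comp P W isOrtho_genericPart fun _ =>
      starProjection_mem_sup_of_mem_genericPart]
    exact congr_arg (block · U W) N.isIdempotentElem_starProjection
  have hnorm' : ‖1 - block P U U‖ ≤ 1 := by
    rw [one_sub_block_starProjection]
    exact norm_block_starProjection_le Nᗮ U U
  have hinj : Function.Injective (block P U U) :=
    injective_block_starProjection disjoint_genericPart_orthogonal
  have hinj' : Function.Injective (1 - block P U U : U →L[𝕜] U) := by
    rw [one_sub_block_starProjection]
    refine injective_block_starProjection ?_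
    rw [N.orthogonal_orthogonal]
    exact disjoint_genericPart
  obtain ⟨R, S, T, hS, hT, hQ, hQadj, hY⟩ := exists_unitary_of_blocks
    (adjoint_block_starProjection N U U) (norm_block_starProjection_le N U U) hnorm' hinj hinj'
    injective_adjoint_block_genericPart (by rw [adjoint_block_starProjection]; exact hidem U)
    (hidem V)
  have hX : block P U U = 1 - S * S := by rw [hS.2, sub_sub_cancel]
  refine ⟨R, S, hS.1, hS.norm_le_one hnorm', hS.injective hinj',
    hS.injective_one_sub (by rwa [sub_sub_cancel]), T, hX ▸ hT, fun x y => ?_⟩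
  rw [map_add, ← coe_block_add_coe_block isOrtho_genericPart
      (starProjection_mem_sup_of_mem_genericPart x.2), ← coe_block_add_coe_block
      isOrtho_genericPart (starProjection_mem_sup_of_mem_genericPart_orthogonal y.2),
    ← hX, ← hQ, ← hQadj, adjoint_block_starProjection, hS.2, ← hY, Submodule.coe_add,
    Submodule.coe_add]
  exact add_add_add_comm _ _ _ _

lemma IsHalmosPair.norm_starProjection_orthogonal [IsClosed (N : Set H)]
    {R : genericPart M N ≃ₗᵢ[𝕜] genericPart Mᗮ N} {S : genericPart M N →L[𝕜] genericPart M N}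
    (h : IsHalmosPair M N R S) (x : genericPart M N) :
    ‖Nᗮ.starProjection (x : H)‖ = ‖S x‖ := by
  obtain ⟨T, -, hT⟩ := h.matrix
  have hproj : Nᗮ.starProjection (x : H) = (S (S x) : H) - (R ((S * T) x) : H) := by
    have hx := hT x 0
    simp only [map_zero, add_zero, Submodule.coe_zero] at hx
    rw [Submodule.starProjection_orthogonal_val, hx, sub_apply, Submodule.coe_sub, ← sub_sub]
    exact congr_arg (· - _) (sub_sub_cancel _ _)
  have hinner : inner 𝕜 (Nᗮ.starProjection (x : H)) (x : H) = inner 𝕜 (S x) (S x) :=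
    calc inner 𝕜 (Nᗮ.starProjection (x : H)) (x : H) = inner 𝕜 (S (S x)) x := by
          rw [hproj, inner_sub_left, isOrtho_genericPart.symm.inner_eq (Submodule.coe_mem _) x.2,
            sub_zero, Submodule.coe_inner]
      _ = inner 𝕜 (S x) (S x) := h.isPositive.inner_left_eq_inner_right _ _
  have hnormSq := Nᗮ.re_inner_starProjection_eq_normSq (x : H)
  rw [hinner, inner_self_eq_norm_sq] at hnormSq
  exact ((sq_eq_sq₀ (norm_nonneg _) (norm_nonneg _)).1 hnormSq).symm

end Halmos

section SimExt

variable {𝕜 H K : Type*} [RCLike 𝕜]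
  [NormedAddCommGroup H] [InnerProductSpace 𝕜 H]
  [NormedAddCommGroup K] [InnerProductSpace 𝕜 K]
  {M N : Submodule 𝕜 H} {A B : H →L[𝕜] K} {hAB : ∀ x ∈ M ⊓ N, A x = B x}

lemma mem_domain_simExt {z : H} :
    z ∈ (simExt M N A B hAB).domain ↔ ∃ m ∈ M, ∃ n ∈ N, m + n = z :=
  Submodule.mem_sup

lemma simExt_apply {m n : H} (hm : m ∈ M) (hn : n ∈ N) (z : (simExt M N A B hAB).domain)
    (hz : m + n = z) : simExt M N A B hAB z = A m + B n :=
  LinearPMap.sup_apply _ ⟨m, hm⟩ ⟨n, hn⟩ z hz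

lemma isBoundedOp_simExt_iff_add :
    IsBoundedOp (simExt M N A B hAB) ↔
      ∃ c : ℝ, ∀ m ∈ M, ∀ n ∈ N, ‖A m + B n‖ ≤ c * ‖m + n‖ := by
  refine exists_congr fun c => ⟨fun h m hm n hn => ?_, fun h z => ?_⟩
  · simpa only [simExt_apply hm hn ⟨m + n, mem_domain_simExt.2 ⟨m, hm, n, hn, rfl⟩⟩ rfl]
      using h ⟨m + n, mem_domain_simExt.2 ⟨m, hm, n, hn, rfl⟩⟩
  · obtain ⟨m, hm, n, hn, hz⟩ := mem_domain_simExt.1 z.2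
    rw [simExt_apply hm hn z hz, ← hz]
    exact h m hm n hn

lemma isBoundedOp_simExt_iff [N.HasOrthogonalProjection] :
    IsBoundedOp (simExt M N A B hAB) ↔
      ∃ c : ℝ, ∀ m ∈ M, ‖(A - B) m‖ ≤ c * ‖Nᗮ.starProjection m‖ := by
  rw [isBoundedOp_simExt_iff_add]
  constructor
  · rintro ⟨c, hc⟩
    refine ⟨c + ‖B‖, fun m hm => ?_⟩
    have hsplit : (A - B) m = (A m + B (-N.starProjection m)) - B (Nᗮ.starProjection m) := by
      rw [Submodule.starProjection_orthogonal_val, sub_apply, map_sub, map_neg]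
      abel
    have hbound := hc m hm _ (neg_mem (N.starProjection_apply_mem m))
    rw [← sub_eq_add_neg m, ← Submodule.starProjection_orthogonal_val] at hbound
    rw [hsplit, add_mul]
    exact norm_sub_le_of_le hbound (B.le_opNorm _)
  · rintro ⟨c, hc⟩
    refine ⟨|c| + ‖B‖, fun m hm n hn => ?_⟩
    have hproj : Nᗮ.starProjection m = Nᗮ.starProjection (m + n) := by
      rw [map_add, (Submodule.starProjection_apply_eq_zero_iff Nᗮ).2
        (N.le_orthogonal_orthogonal hn), add_zero]
    calc ‖A m + B n‖ = ‖(A - B) m + B (m + n)‖ := by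
          rw [sub_apply, map_add]
          congr 1
          abel
      _ ≤ c * ‖Nᗮ.starProjection (m + n)‖ + ‖B‖ * ‖m + n‖ :=
          norm_add_le_of_le (hproj ▸ hc m hm) (B.le_opNorm _)
      _ ≤ |c| * ‖m + n‖ + ‖B‖ * ‖m + n‖ := by
          gcongr
          · exact le_abs_self c
          · exact Nᗮ.norm_starProjection_apply_le _
      _ = (|c| + ‖B‖) * ‖m + n‖ := (add_mul _ _ _).symm

lemma norm_le_norm_add_of_inner_eq_zero {u v : H} (h : inner 𝕜 u v = 0) : ‖u‖ ≤ ‖u + v‖ := by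
  have hpyth := norm_add_sq_eq_norm_sq_add_norm_sq_of_inner_eq_zero u v h
  nlinarith [norm_nonneg u, norm_nonneg (u + v), mul_self_nonneg ‖v‖]

lemma norm_apply_add_le_of_mem_orthogonal [N.HasOrthogonalProjection] {D : H →L[𝕜] K}
    {b x : H} {c : ℝ} (hb : b ∈ Nᗮ) (hbx : inner 𝕜 b x = 0)
    (hc : ‖D x‖ ≤ c * ‖Nᗮ.starProjection x‖) :
    ‖D (b + x)‖ ≤ (‖D‖ + |c|) * ‖Nᗮ.starProjection (b + x)‖ := by
  have hPb : Nᗮ.starProjection b = b := Submodule.starProjection_eq_self_iff.2 hb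
  have horth : inner 𝕜 b (Nᗮ.starProjection x) = 0 := by
    rw [← Nᗮ.inner_starProjection_left_eq_right, hPb, hbx]
  have hx_le : ‖Nᗮ.starProjection x‖ ≤ ‖b + Nᗮ.starProjection x‖ := by
    rw [add_comm]
    exact norm_le_norm_add_of_inner_eq_zero (inner_eq_zero_symm.1 horth)
  calc ‖D (b + x)‖ ≤ ‖D‖ * ‖b‖ + c * ‖Nᗮ.starProjection x‖ := by
        rw [map_add]
        exact norm_add_le_of_le (D.le_opNorm b) hc
    _ ≤ ‖D‖ * ‖b + Nᗮ.starProjection x‖ + |c| * ‖b + Nᗮ.starProjection x‖ := by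
        gcongr
        · exact norm_le_norm_add_of_inner_eq_zero horth
        · exact le_abs_self c
    _ = (‖D‖ + |c|) * ‖Nᗮ.starProjection (b + x)‖ := by rw [map_add, hPb, add_mul]

theorem isBoundedOp_simExt_iff_genericPart [CompleteSpace H] [hM : IsClosed (M : Set H)]
    [hN : IsClosed (N : Set H)] :
    IsBoundedOp (simExt M N A B hAB) ↔
      ∃ c : ℝ, ∀ x : genericPart M N, ‖(A - B) x‖ ≤ c * ‖Nᗮ.starProjection (x : H)‖ := by
  rw [isBoundedOp_simExt_iff]
  refine ⟨fun ⟨c, hc⟩ => ⟨c, fun x => hc x (genericPart_le x.2)⟩,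
    fun ⟨c, hc⟩ => ⟨‖A - B‖ + |c|, fun m hm => ?_⟩⟩
  have : IsClosed ((M ⊓ N : Submodule 𝕜 H) : Set H) := hM.inter hN
  have : IsClosed ((M ⊓ Nᗮ : Submodule 𝕜 H) : Set H) := hM.inter N.isClosed_orthogonal
  rw [← sup_genericPart (M := M) (N := N)] at hm
  obtain ⟨a, ha, _, hbx, rfl⟩ := Submodule.mem_sup.1 hm
  obtain ⟨b, hb, x, hx, rfl⟩ := Submodule.mem_sup.1 hbx
  have hDa : (A - B) a = 0 := sub_eq_zero.2 (hAB a ha)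
  have hPa : Nᗮ.starProjection a = 0 :=
    (Submodule.starProjection_apply_eq_zero_iff Nᗮ).2 (N.le_orthogonal_orthogonal ha.2)
  rw [map_add, hDa, zero_add, map_add (Nᗮ.starProjection), hPa, zero_add]
  exact norm_apply_add_le_of_mem_orthogonal hb.2 ((mem_genericPart.1 hx).2.2 b hb) (hc ⟨x, hx⟩)

end SimExt

end TwoSubspaces

theorem theorem5p6 {𝕜 H K : Type*} [RCLike 𝕜]
    [NormedAddCommGroup H] [InnerProductSpace 𝕜 H] [CompleteSpace H]
    [NormedAddCommGroup K] [InnerProductSpace 𝕜 K] [CompleteSpace K]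
    (M N : Submodule 𝕜 H) [IsClosed (M : Set H)] [IsClosed (N : Set H)]
    (A B : H →L[𝕜] K) (hAB : ∀ x ∈ M ⊓ N, A x = B x) :
    (TwoSubspaces.genericPart M N = ⊥ →
      TwoSubspaces.IsBoundedOp (TwoSubspaces.simExt M N A B hAB)) ∧
    (TwoSubspaces.genericPart M N ≠ ⊥ →
      (∃ (R : TwoSubspaces.genericPart M N ≃ₗᵢ[𝕜] TwoSubspaces.genericPart Mᗮ N)
        (S : TwoSubspaces.genericPart M N →L[𝕜] TwoSubspaces.genericPart M N),
        TwoSubspaces.IsHalmosPair M N R S) ∧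
      ∀ (R : TwoSubspaces.genericPart M N ≃ₗᵢ[𝕜] TwoSubspaces.genericPart Mᗮ N)
        (S : TwoSubspaces.genericPart M N →L[𝕜] TwoSubspaces.genericPart M N),
        TwoSubspaces.IsHalmosPair M N R S →
        (TwoSubspaces.IsBoundedOp (TwoSubspaces.simExt M N A B hAB) ↔
          (ContinuousLinearMap.adjoint (TwoSubspaces.diffRestrict M N A B)).range ≤ S.range)) := by
  refine ⟨fun hbot => ?_, fun _ => ⟨TwoSubspaces.exists_isHalmosPair M N, fun R S hRS => ?_⟩⟩
  · refine TwoSubspaces.isBoundedOp_simExt_iff_genericPart.2 ⟨0, fun x => ?_⟩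
    rw [(Submodule.eq_bot_iff _).1 hbot x x.2, map_zero, norm_zero, zero_mul]
  · have hDouglas := TwoSubspaces.range_adjoint_le_range_adjoint_iff
      (TwoSubspaces.diffRestrict M N A B) S
    rw [hRS.isPositive.isSelfAdjoint.adjoint_eq] at hDouglas
    simp only [hDouglas, TwoSubspaces.isBoundedOp_simExt_iff_genericPart,
      hRS.norm_starProjection_orthogonal]
    rfl
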